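/- Let $m_1,m_2,p_1,p_2,N\ge 1$ be integers, $m=m_1m_2$, $p=p_1p_2$, and let $\mathcal D$ be the set of Kronecker-structured dictionaries, i.e. of matrices $D=A\otimes B\in\mathbb R^{m\times p}$ with $A\in\mathbb R^{m_1\times p_1}$, $B\in\mathbb R^{m_2\times p_2}$, all of whose columns have unit Euclidean norm. Fix $D_0\in\mathcal D$ and $r>0$, and let $\mathcal X(D_0,r)=\{D\in\mathcal D:\|D-D_0\|_F^2<r^2\}$. Let $x$ be a zero-mean random vector in $\mathbb R^p$ with known distribution whose entries have finite second moments and whose covariance matrix $\Sigma_x$ is nonzero. For a dictionary $D$, let $Y=(y_1,\dots,y_N)$ consist of $N$ i.i.d. copies of $y=Dx+n$, where $n\sim\mathcal N(0,\sigma^2 I_m)$ is independent of $x$ and $\sigma>0$. Let $$\varepsilon^*=\inf_{\widehat D}\ \sup_{D\in\mathcal X(D_0,r)}\mathbb E_Y\big\|\widehat D(Y)-D\big\|_F^2$$ be the minimax risk, where the infimum is over all measurable estimators $\widehat D$ with values in $\mathbb R^{m\times p}$. Let $0<t<1$ and $0<c_1<\frac{t}{8\log 2}$ (natural logarithm). If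 $\varepsilon^*\le\frac{2p(1-t)}{8}\min\{1,\frac{r^2}{4p}\}$ (in particular, if some estimator has worst-case mean squared error at most this value), then $$\varepsilon^*\ \ge\ \frac{C_1r^2\sigma^2}{Np\,\|\Sigma_x\|_2}\Big(c_1\big(p_1(m_1-1)+p_2(m_2-1)\big)-3\Big),\qquad C_1=\frac{(1-t)p}{32r^2},$$ where $\|\Sigma_x\|_2$ is the spectral norm. -/

import Mathlib

open MeasureTheory ProbabilityTheory
open scoped ENNReal Kronecker

noncomputable section

namespace KSDict

/-- The squared Frobenius norm of a real matrix. -/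
def frobSq {m n : Type*} [Fintype m] [Fintype n] (M : Matrix m n ℝ) : ℝ :=
  ∑ i, ∑ j, M i j ^ 2

/-- The spectral norm of a square real matrix: its operator norm on Euclidean space. -/
def spectralNorm {n : Type*} [Fintype n] [DecidableEq n] (M : Matrix n n ℝ) : ℝ :=
  ‖Matrix.toEuclideanCLM (n := n) (𝕜 := ℝ) M‖

/-- Kronecker-structured dictionaries: Kronecker products `A ⊗ B` with columns of unit
Euclidean norm. Rows are indexed by `Fin m₁ × Fin m₂` and columns by `Fin p₁ × Fin p₂`. -/
def dictionaries (m₁ m₂ p₁ p₂ : ℕ) : Set (Matrix (Fin m₁ × Fin m₂) (Fin p₁ × Fin p₂) ℝ) :=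
  {D | (∀ j, ∑ i, D i j ^ 2 = 1) ∧
    ∃ (A : Matrix (Fin m₁) (Fin p₁) ℝ) (B : Matrix (Fin m₂) (Fin p₂) ℝ), D = A ⊗ₖ B}

/-- Kronecker-structured dictionaries at Frobenius distance less than `r` from `D₀`. -/
def neighborhood {m₁ m₂ p₁ p₂ : ℕ}
    (D₀ : Matrix (Fin m₁ × Fin m₂) (Fin p₁ × Fin p₂) ℝ) (r : ℝ) :
    Set (Matrix (Fin m₁ × Fin m₂) (Fin p₁ × Fin p₂) ℝ) :=
  {D | D ∈ dictionaries m₁ m₂ p₁ p₂ ∧ frobSq (D - D₀) < r ^ 2}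

/-- The covariance matrix of a random vector with law `μ`. -/
def covMatrix {n : Type*} (μ : Measure (n → ℝ)) : Matrix n n ℝ :=
  Matrix.of fun i j => cov[fun x => x i, fun x => x j; μ]

/-- White Gaussian noise: independent coordinates of mean zero and variance `σ ^ 2`. -/
def noiseLaw (m : Type*) [Fintype m] (σ : ℝ) : Measure (m → ℝ) :=
  Measure.pi fun _ => gaussianReal 0 (σ ^ 2).toNNReal

/-- The law of one observation `y = D x + n`, where `x` has law `μ` and `n` is independent
white Gaussian noise. -/
def observationLaw {m n : Type*} [Fintype m] [Fintype n] (μ : Measure (n → ℝ)) (σ : ℝ)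
    (D : Matrix m n ℝ) : Measure (m → ℝ) :=
  (μ.prod (noiseLaw m σ)).map fun z => D.mulVec z.1 + z.2

/-- The joint law of `N` independent observations; `Y k` is the `k`-th observation. -/
def sampleLaw {m n : Type*} [Fintype m] [Fintype n] (N : ℕ) (μ : Measure (n → ℝ)) (σ : ℝ)
    (D : Matrix m n ℝ) : Measure (Fin N → m → ℝ) :=
  Measure.pi fun _ => observationLaw μ σ D

/-- The worst-case mean squared error over the neighborhood of `D₀` of an estimator `Dhat`. -/
def worstCaseMSE {m₁ m₂ p₁ p₂ : ℕ} (N : ℕ) (μ : Measure (Fin p₁ × Fin p₂ → ℝ)) (σ : ℝ)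
    (D₀ : Matrix (Fin m₁ × Fin m₂) (Fin p₁ × Fin p₂) ℝ) (r : ℝ)
    (Dhat : (Fin N → Fin m₁ × Fin m₂ → ℝ) → Matrix (Fin m₁ × Fin m₂) (Fin p₁ × Fin p₂) ℝ) :
    ℝ≥0∞ :=
  ⨆ D ∈ neighborhood D₀ r, ∫⁻ Y, ENNReal.ofReal (frobSq (Dhat Y - D)) ∂(sampleLaw N μ σ D)

/-- The minimax risk: the infimum of the worst-case mean squared error over all
(entrywise Borel measurable) matrix-valued estimators. -/
def minimaxRisk {m₁ m₂ p₁ p₂ : ℕ} (N : ℕ) (μ : Measure (Fin p₁ × Fin p₂ → ℝ)) (σ : ℝ)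
    (D₀ : Matrix (Fin m₁ × Fin m₂) (Fin p₁ × Fin p₂) ℝ) (r : ℝ) : ℝ≥0∞ :=
  ⨅ (Dhat : (Fin N → Fin m₁ × Fin m₂ → ℝ) → Matrix (Fin m₁ × Fin m₂) (Fin p₁ × Fin p₂) ℝ)
    (_ : ∀ i j, Measurable fun Y => Dhat Y i j), worstCaseMSE N μ σ D₀ r Dhat

end KSDict

end

/-!
The bound is proved by Assouad's method: no packing of the set of dictionaries is needed.

Write `D₀ = A ⊗ B` with both factors having unit columns (`exists_unit_factors`) and perturb only
one factor, the one with more degrees of freedom, say `A`. Tilting each column `a` of `A` towards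
the `2 ^ (m₁ - 1)` sign vectors in an orthonormal basis of `aᗮ` (`exists_cube_of_unit_columns`) and
tensoring with `B` produces the vertices of a cube in the space of matrices, all of them
Kronecker-structured dictionaries. With `p = p₁ p₂`, the cube has `n = p₁ (m₁ - 1)` Frobenius
orthogonal half-edges of squared length `δ = p ε / n`, where `ε ≤ 1` measures the tilt, and its
vertices stay in the neighborhood of `D₀` when `2 p ε < r ^ 2`.

An estimator of the dictionary yields a guess of each sign of the vertex, by projecting onto the
corresponding edge, and by Bessel's inequality its squared error is at least `δ` times the number
of wrong guesses. A sign is hard to guess when the samples from two neighboring vertices `D`, `D'`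
have close laws. Conditionally on the coefficient vectors `X k`, these are white noises around
`D X k` and `D' X k`. Gaussian laws with a common variance have a geometric midpoint, the Gaussian
law around the average of the means (`IsMidpoint`), so their Hellinger affinity is explicit, and
the two error probabilities of a test sum to at least `1 / 2 - 3 / (32 σ²) * ∑ ‖(D - D') X k‖²`.
Averaging over `X` replaces the sum by at most `N ‖Σ‖ ‖D - D'‖_F²` (`le_sampleLaw_add_sampleLaw`).
With `κ = N ‖Σ‖ / σ²` this gives (`le_of_cube`)

  risk `≥ (p ε / 4) (1 - κ p ε / n)` for all `0 < ε ≤ M = min 1 (r ^ 2 / (4 p))`.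

For `ε = M` the assumed upper bound `(1 - t) p M / 4` on the risk forces `κ p M / n ≥ t`. Hence
`ε = t n / (2 κ p)` is admissible, and it gives risk `≥ (t n / (8 κ)) (1 - t / 2)`, which exceeds
the claimed bound because `c₁ ≤ t / 4` and `n` is at least half of `p₁ (m₁ - 1) + p₂ (m₂ - 1)`
(`ofReal_le_of_forall_radius`).
-/

namespace KSDict

/-! ### Testing between Gaussian laws -/

/-- A product of measures with densities has the product density. -/
lemma pi_withDensity {ι : Type*} [Fintype ι] {E : ι → Type*} [∀ i, MeasurableSpace (E i)]
    (ρ : ∀ i, Measure (E i)) [∀ i, IsProbabilityMeasure (ρ i)] (f : ∀ i, E i → ℝ≥0∞)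
    (hf : ∀ i, Measurable (f i)) [∀ i, SigmaFinite ((ρ i).withDensity (f i))] :
    Measure.pi (fun i => (ρ i).withDensity (f i)) =
      (Measure.pi ρ).withDensity fun x => ∏ i, f i (x i) := by
  refine Measure.pi_eq fun s hs => ?_
  rw [withDensity_apply _ (MeasurableSet.univ_pi hs),
    ← lintegral_indicator (MeasurableSet.univ_pi hs)]
  have h1 : ∀ x : ∀ i, E i, (Set.univ.pi s).indicator (fun x => ∏ i, f i (x i)) x =
      ∏ i, (s i).indicator (f i) (x i) := by
    intro x
    by_cases hx : x ∈ Set.univ.pi s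
    · rw [Set.indicator_of_mem hx]
      exact Finset.prod_congr rfl fun i _ => (Set.indicator_of_mem (hx i trivial) _).symm
    · rw [Set.indicator_of_notMem hx]
      simp only [Set.mem_univ_pi, not_forall] at hx
      obtain ⟨i, hi⟩ := hx
      exact (Finset.prod_eq_zero (Finset.mem_univ i) (Set.indicator_of_notMem hi _)).symm
  simp_rw [h1]
  have hm : ∀ i, Measurable ((s i).indicator (f i)) := fun i => (hf i).indicator (hs i)
  rw [lintegral_prod_eq_prod_lintegral_of_indepFun Finset.univ
    (fun i (x : ∀ i, E i) => (s i).indicator (f i) (x i))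
    (iIndepFun_pi fun i => (hm i).aemeasurable) fun i => (hm i).comp (measurable_pi_apply i)]
  refine Finset.prod_congr rfl fun i _ => ?_
  rw [(measurePreserving_eval ρ i).lintegral_comp (hm i), lintegral_indicator (hs i),
    withDensity_apply _ (hs i)]

/-- `ρ` is a geometric midpoint of `P` and `Q`, with constant `c`: relative to `ρ` both have
densities, and the product of these densities is constantly `c`. If `ρ` is a probability measure,
`√c` is then the Hellinger affinity of `P` and `Q`. -/
def IsMidpoint {α : Type*} [MeasurableSpace α] (c : ℝ) (P Q ρ : Measure α) : Prop :=
  ∃ f g : α → ℝ, Measurable f ∧ Measurable g ∧ (∀ x, 0 ≤ f x) ∧ (∀ x, 0 ≤ g x) ∧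
    P = ρ.withDensity (fun x => ENNReal.ofReal (f x)) ∧
    Q = ρ.withDensity (fun x => ENNReal.ofReal (g x)) ∧ ∀ x, f x * g x = c

lemma IsMidpoint.pi {ι : Type*} [Fintype ι] {E : ι → Type*} [∀ i, MeasurableSpace (E i)]
    {P Q ρ : ∀ i, Measure (E i)} [∀ i, IsProbabilityMeasure (P i)]
    [∀ i, IsProbabilityMeasure (Q i)] [∀ i, IsProbabilityMeasure (ρ i)] {c : ι → ℝ}
    (h : ∀ i, IsMidpoint (c i) (P i) (Q i) (ρ i)) :
    IsMidpoint (∏ i, c i) (Measure.pi P) (Measure.pi Q) (Measure.pi ρ) := by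
  choose f g hf hg hf0 hg0 hP hQ hfg using h
  refine ⟨fun x => ∏ i, f i (x i), fun x => ∏ i, g i (x i),
    Finset.measurable_fun_prod _ fun i _ => (hf i).comp (measurable_pi_apply i),
    Finset.measurable_fun_prod _ fun i _ => (hg i).comp (measurable_pi_apply i),
    fun x => Finset.prod_nonneg fun i _ => hf0 i _,
    fun x => Finset.prod_nonneg fun i _ => hg0 i _, ?_, ?_, fun x => ?_⟩
  · have : ∀ i, SigmaFinite ((ρ i).withDensity fun x => ENNReal.ofReal (f i x)) :=
      fun i => hP i ▸ inferInstance
    simp_rw [ENNReal.ofReal_prod_of_nonneg fun i _ => hf0 i _]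
    rw [← pi_withDensity ρ (fun i x => ENNReal.ofReal (f i x)) fun i => (hf i).ennreal_ofReal]
    exact congrArg _ (funext hP)
  · have : ∀ i, SigmaFinite ((ρ i).withDensity fun x => ENNReal.ofReal (g i x)) :=
      fun i => hQ i ▸ inferInstance
    simp_rw [ENNReal.ofReal_prod_of_nonneg fun i _ => hg0 i _]
    rw [← pi_withDensity ρ (fun i x => ENNReal.ofReal (g i x)) fun i => (hg i).ennreal_ofReal]
    exact congrArg _ (funext hQ)
  · rw [← Finset.prod_mul_distrib]
    exact Finset.prod_congr rfl fun i _ => hfg i _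

lemma gaussianReal_eq_withDensity_gaussianReal (a c : ℝ) {v : NNReal} (hv : v ≠ 0) :
    gaussianReal a v = (gaussianReal c v).withDensity fun x =>
      ENNReal.ofReal (Real.exp ((a - c) * (x - c) / v - (a - c) ^ 2 / (2 * v))) := by
  rw [gaussianReal_of_var_ne_zero c hv, gaussianReal_of_var_ne_zero a hv,
    ← withDensity_mul _ (measurable_gaussianPDF c v) (by fun_prop)]
  congr 1
  ext x
  have hv' : (v : ℝ) ≠ 0 := by exact_mod_cast hv
  rw [Pi.mul_apply, gaussianPDF, gaussianPDF, ← ENNReal.ofReal_mul (gaussianPDFReal_nonneg _ _ _)]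
  simp only [gaussianPDFReal]
  rw [mul_assoc (√_)⁻¹, ← Real.exp_add]
  congr 3
  field_simp
  ring

lemma isMidpoint_gaussianReal (a b : ℝ) {v : NNReal} (hv : v ≠ 0) :
    IsMidpoint (Real.exp (-((a - b) ^ 2 / (4 * v)))) (gaussianReal a v) (gaussianReal b v)
      (gaussianReal ((a + b) / 2) v) := by
  have hv' : (v : ℝ) ≠ 0 := by exact_mod_cast hv
  refine ⟨_, _, ?_, ?_, fun x => (Real.exp_pos _).le, fun x => (Real.exp_pos _).le,
    gaussianReal_eq_withDensity_gaussianReal a ((a + b) / 2) hv,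
    gaussianReal_eq_withDensity_gaussianReal b ((a + b) / 2) hv, fun x => ?_⟩
  · fun_prop
  · fun_prop
  · rw [← Real.exp_add]
    congr 1
    field_simp
    ring

/-- Two laws with a geometric midpoint cannot be told apart too well: the two error
probabilities of any test sum to at least `3 / 4 * √c - 1 / 4`. -/
lemma IsMidpoint.le_add_compl {α : Type*} [MeasurableSpace α] {c : ℝ} {P Q ρ : Measure α}
    [IsProbabilityMeasure P] [IsProbabilityMeasure Q] [IsProbabilityMeasure ρ]
    (h : IsMidpoint c P Q ρ) {T : Set α} (hT : MeasurableSet T) :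
    3 / 4 * √c - 1 / 4 ≤ P.real T + Q.real Tᶜ := by
  obtain ⟨f, g, hf, hg, hf0, hg0, hP, hQ, hfg⟩ := h
  have key : ∀ (S : Measure α) [IsProbabilityMeasure S] (k : α → ℝ), Measurable k →
      (∀ x, 0 ≤ k x) → S = ρ.withDensity (fun x => ENNReal.ofReal (k x)) →
      Integrable k ρ ∧ ∀ U, MeasurableSet U → S.real U = ∫ x in U, k x ∂ρ := by
    intro S _ k hk hk0 hS
    have hi : Integrable k ρ := by
      refine ⟨hk.aestronglyMeasurable, ?_⟩
      rw [hasFiniteIntegral_iff_ofReal (.of_forall hk0), ← setLIntegral_univ,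
        ← withDensity_apply _ MeasurableSet.univ, ← hS]
      exact measure_lt_top _ _
    refine ⟨hi, fun U hU => ?_⟩
    rw [measureReal_def, hS, withDensity_apply _ hU,
      integral_eq_lintegral_of_nonneg_ae (.of_forall hk0) hk.aestronglyMeasurable]
  obtain ⟨hfi, hfU⟩ := key P f hf hf0 hP
  obtain ⟨hgi, hgU⟩ := key Q g hg hg0 hQ
  have hf1 : ∫ x, f x ∂ρ = 1 := by
    simpa using (hfU _ MeasurableSet.univ).symm
  have hg1 : ∫ x, g x ∂ρ = 1 := by
    simpa using (hgU _ MeasurableSet.univ).symm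
  -- `min p q ≥ 3/4 √(p q) - (p + q) / 8` is the AM-GM inequality
  -- `6 √(p q) ≤ p + 9 q` and its mirror image.
  have hmin : ∀ x, 3 / 4 * √c - (f x + g x) / 8 ≤ min (f x) (g x) := by
    intro x
    rw [← hfg x, Real.sqrt_mul (hf0 x)]
    have h1 := Real.sq_sqrt (hf0 x)
    have h2 := Real.sq_sqrt (hg0 x)
    have h3 := Real.sqrt_nonneg (f x)
    have h4 := Real.sqrt_nonneg (g x)
    refine le_min ?_ ?_ <;> nlinarith [sq_nonneg (3 * √(f x) - √(g x)),
      sq_nonneg (√(f x) - 3 * √(g x))]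
  have hs : Integrable (fun x => (f x + g x) / 8) ρ := (hfi.add hgi).div_const _
  have hi : Integrable (fun x => 3 / 4 * √c - (f x + g x) / 8) ρ := (integrable_const _).sub hs
  have htot : ∫ x, (3 / 4 * √c - (f x + g x) / 8) ∂ρ = 3 / 4 * √c - 1 / 4 := by
    rw [integral_sub (integrable_const _) hs, integral_div,
      integral_add hfi hgi, hf1, hg1]
    simp
    norm_num
  rw [hfU _ hT, hgU _ hT.compl, ← htot, ← integral_add_compl hT hi]
  exact add_le_add
    (setIntegral_mono hi.integrableOn hfi.integrableOn fun x => (hmin x).trans (min_le_left _ _))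
    (setIntegral_mono hi.integrableOn hgi.integrableOn fun x => (hmin x).trans (min_le_right _ _))

/-- Two-point bound for samples of Gaussian white noise around the means `a` and `b`. -/
lemma le_noise_add_noise {κ m : Type*} [Fintype κ] [Fintype m] {σ : ℝ} (hσ : 0 < σ)
    (a b : κ → m → ℝ) {T : Set (κ → m → ℝ)} (hT : MeasurableSet T) :
    1 / 2 - 3 / (32 * σ ^ 2) * ∑ k, ∑ i, (a k i - b k i) ^ 2 ≤
      (Measure.pi fun _ : κ => noiseLaw m σ).real {w | a + w ∈ T} +
      (Measure.pi fun _ : κ => noiseLaw m σ).real {w | b + w ∈ Tᶜ} := by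
  set v := (σ ^ 2).toNNReal with hv
  have hv0 : v ≠ 0 := by simpa [hv] using hσ.ne'
  have hvσ : (v : ℝ) = σ ^ 2 := Real.coe_toNNReal _ (sq_nonneg σ)
  have hshift : ∀ (a : κ → m → ℝ) (U : Set (κ → m → ℝ)), MeasurableSet U →
      (Measure.pi fun _ : κ => noiseLaw m σ).real {w | a + w ∈ U} =
      (Measure.pi fun k => Measure.pi fun i => gaussianReal (a k i) v).real U := by
    intro a U hU
    have h1 : (Measure.pi fun _ : κ => noiseLaw m σ).map (fun w k => (fun i => a k i + w k i)) =
        Measure.pi fun k => Measure.pi fun i => gaussianReal (a k i) v := by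
      have h2 : ∀ k, (noiseLaw m σ).map (fun w i => a k i + w i) =
          Measure.pi fun i => gaussianReal (a k i) v := by
        intro k
        have h3 : ∀ i, (gaussianReal 0 v).map (fun x => a k i + x) = gaussianReal (a k i) v := by
          intro i
          rw [gaussianReal_map_const_add, zero_add]
        have : ∀ i, SigmaFinite ((gaussianReal 0 v).map (fun x => a k i + x)) :=
          fun i => by rw [h3]; infer_instance
        rw [noiseLaw, Measure.pi_map_pi (f := fun i x => a k i + x) (fun i => by fun_prop)]
        exact congrArg _ (funext h3)
      have : ∀ k, SigmaFinite ((noiseLaw m σ).map (fun w i => a k i + w i)) :=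
        fun k => by rw [h2]; infer_instance
      rw [← funext h2]
      exact Measure.pi_map_pi (μ := fun _ : κ => noiseLaw m σ)
        (f := fun k (w : m → ℝ) i => a k i + w i)
        (fun k => Measurable.aemeasurable (by fun_prop))
    rw [← h1, map_measureReal_apply (by fun_prop) hU]
    rfl
  rw [hshift a T hT, hshift b _ hT.compl]
  have hmid := IsMidpoint.pi fun k : κ => IsMidpoint.pi fun i : m =>
    isMidpoint_gaussianReal (a k i) (b k i) hv0
  refine le_trans ?_ (hmid.le_add_compl hT)
  simp_rw [← Real.exp_sum]
  rw [← Real.exp_half]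
  have := Real.add_one_le_exp ((∑ k, ∑ i, -((a k i - b k i) ^ 2 / (4 * (v : ℝ)))) / 2)
  have h5 : (∑ k, ∑ i, -((a k i - b k i) ^ 2 / (4 * (v : ℝ)))) / 2 =
      - (1 / (8 * σ ^ 2) * ∑ k, ∑ i, (a k i - b k i) ^ 2) := by
    simp_rw [Finset.sum_neg_distrib, ← Finset.sum_div, hvσ]
    field_simp
    ring
  rw [h5] at this ⊢
  have h6 : 3 / (32 * σ ^ 2) * ∑ k, ∑ i, (a k i - b k i) ^ 2 =
      3 / 4 * (1 / (8 * σ ^ 2) * ∑ k, ∑ i, (a k i - b k i) ^ 2) := by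
    field_simp; ring
  linarith

/-! ### Laws of samples from a dictionary -/

lemma ofReal_integral_le_lintegral {α : Type*} [MeasurableSpace α] {ν : Measure α} {f : α → ℝ}
    (hf : Integrable f ν) : ENNReal.ofReal (∫ x, f x ∂ν) ≤ ∫⁻ x, ENNReal.ofReal (f x) ∂ν := by
  rw [integral_eq_lintegral_pos_part_sub_lintegral_neg_part hf]
  exact (ENNReal.ofReal_le_ofReal (sub_le_self _ ENNReal.toReal_nonneg)).trans
    ENNReal.ofReal_toReal_le

lemma memLp_mulVec {m n : Type*} [Fintype n] {μ : Measure (n → ℝ)}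
    (hL2 : ∀ i, MemLp (fun x => x i) 2 μ) (M : Matrix m n ℝ) (i : m) :
    MemLp (fun x => M.mulVec x i) 2 μ := by
  have : (fun x : n → ℝ => M.mulVec x i) = fun x => ∑ j, M i j * x j := rfl
  rw [this]
  exact memLp_finsetSum _ fun j _ => (hL2 j).const_mul _

lemma dotProduct_mulVec_le_spectralNorm {n : Type*} [Fintype n] [DecidableEq n]
    (M : Matrix n n ℝ) (d : n → ℝ) : d ⬝ᵥ M.mulVec d ≤ spectralNorm M * ∑ j, d j ^ 2 := by
  have h1 : d ⬝ᵥ M.mulVec d = inner ℝ (WithLp.toLp 2 d)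
      (Matrix.toEuclideanCLM (n := n) (𝕜 := ℝ) M (WithLp.toLp 2 d)) := by
    simp [EuclideanSpace.inner_eq_star_dotProduct, dotProduct_comm]
  have h2 : ∑ j, d j ^ 2 = ‖(WithLp.toLp 2 d : EuclideanSpace ℝ n)‖ ^ 2 := by
    simp [EuclideanSpace.real_norm_sq_eq]
  rw [h1, h2]
  refine (real_inner_le_norm _ _).trans ?_
  have := (Matrix.toEuclideanCLM (n := n) (𝕜 := ℝ) M).le_opNorm (WithLp.toLp 2 d)
  rw [spectralNorm]
  nlinarith [norm_nonneg (WithLp.toLp 2 d : EuclideanSpace ℝ n)]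

/-- For a centred `x`, `𝔼 ‖M x‖² = tr (M Σ Mᵀ) ≤ ‖Σ‖ ‖M‖_F²`. -/
lemma integral_sum_mulVec_sq_le {m n : Type*} [Fintype m] [Fintype n] [DecidableEq n]
    {μ : Measure (n → ℝ)}
    (hL2 : ∀ i, MemLp (fun x => x i) 2 μ) (hmean : ∀ i, ∫ x, x i ∂μ = 0) (M : Matrix m n ℝ) :
    ∫ x, ∑ i, M.mulVec x i ^ 2 ∂μ ≤ spectralNorm (covMatrix μ) * frobSq M := by
  rw [integral_finsetSum _ fun i _ => (memLp_mulVec hL2 M i).integrable_sq, frobSq,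
    Finset.mul_sum]
  refine Finset.sum_le_sum fun i _ => ?_
  refine le_trans (le_of_eq ?_) (dotProduct_mulVec_le_spectralNorm (covMatrix μ) (M i))
  have hint : ∀ j l, Integrable (fun x : n → ℝ => (M i j * x j) * (M i l * x l)) μ :=
    fun j l => ((hL2 j).const_mul _).integrable_mul ((hL2 l).const_mul _)
  have h1 : ∀ x : n → ℝ, M.mulVec x i ^ 2 = ∑ j, ∑ l, (M i j * x j) * (M i l * x l) := by
    intro x
    rw [sq, Matrix.mulVec, dotProduct, Finset.sum_mul_sum]
  simp_rw [h1]
  rw [integral_finsetSum _ fun j _ => integrable_finsetSum _ fun l _ => hint j l, dotProduct]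
  refine Finset.sum_congr rfl fun j _ => ?_
  rw [integral_finsetSum _ fun l _ => hint j l, Matrix.mulVec, dotProduct, Finset.mul_sum]
  refine Finset.sum_congr rfl fun l _ => ?_
  have h2 : covMatrix μ j l = ∫ x, x j * x l ∂μ := by
    simp [covMatrix, covariance, hmean]
  rw [h2, ← integral_mul_const, ← integral_const_mul]
  congr 1
  ext x
  ring

instance noiseLaw_isProbabilityMeasure (m : Type*) [Fintype m] (σ : ℝ) :
    IsProbabilityMeasure (noiseLaw m σ) := by
  unfold noiseLaw; infer_instance

/-- Conditionally on the coefficient vectors `X`, the sample is white noise around `D X`. -/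
lemma sampleLaw_apply {m n : Type*} [Fintype m] [Fintype n] (N : ℕ) (μ : Measure (n → ℝ))
    [IsProbabilityMeasure μ] (σ : ℝ) (D : Matrix m n ℝ) {T : Set (Fin N → m → ℝ)}
    (hT : MeasurableSet T) :
    Measurable (fun X : Fin N → n → ℝ => (Measure.pi fun _ : Fin N => noiseLaw m σ)
      {w | (fun k => D.mulVec (X k)) + w ∈ T}) ∧
    sampleLaw N μ σ D T = ∫⁻ X, (Measure.pi fun _ : Fin N => noiseLaw m σ)
      {w | (fun k => D.mulVec (X k)) + w ∈ T} ∂(Measure.pi fun _ : Fin N => μ) := by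
  have hD : Measurable fun x : n → ℝ => D.mulVec x :=
    (Continuous.matrix_mulVec continuous_const continuous_id).measurable
  have hg : Measurable fun z : (n → ℝ) × (m → ℝ) => D.mulVec z.1 + z.2 :=
    (hD.comp measurable_fst).add measurable_snd
  have hG : Measurable fun z : (Fin N → n → ℝ) × (Fin N → m → ℝ) =>
      (fun k => D.mulVec (z.1 k)) + z.2 := by
    refine Measurable.add (measurable_pi_lambda _ fun k => hD.comp ?_) measurable_snd
    exact (measurable_pi_apply k).comp measurable_fst
  have hU := hG hT
  refine ⟨measurable_measure_prodMk_left hU, ?_⟩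
  refine Eq.trans ?_ (Measure.prod_apply hU)
  have hmp := measurePreserving_arrowProdEquivProdArrow (n → ℝ) (m → ℝ) (Fin N)
    (fun _ => μ) (fun _ => noiseLaw m σ)
  rw [← hmp.measure_preimage hU.nullMeasurableSet]
  have : IsProbabilityMeasure
      ((μ.prod (noiseLaw m σ)).map fun z : (n → ℝ) × (m → ℝ) => D.mulVec z.1 + z.2) :=
    Measure.isProbabilityMeasure_map hg.aemeasurable
  have h1 := Measure.pi_map_pi (μ := fun _ : Fin N => μ.prod (noiseLaw m σ))
    (f := fun _ z => D.mulVec z.1 + z.2) fun _ => hg.aemeasurable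
  rw [sampleLaw]
  simp only [observationLaw]
  rw [← h1, Measure.map_apply (by fun_prop) hT]
  rfl

/-- Two-point bound for the laws of samples from two dictionaries. -/
lemma le_sampleLaw_add_sampleLaw {m n : Type*} [Fintype m] [Fintype n] [DecidableEq n] (N : ℕ)
    {μ : Measure (n → ℝ)} [IsProbabilityMeasure μ]
    (hL2 : ∀ i, MemLp (fun x => x i) 2 μ) (hmean : ∀ i, ∫ x, x i ∂μ = 0)
    {σ : ℝ} (hσ : 0 < σ) (D D' : Matrix m n ℝ) {T : Set (Fin N → m → ℝ)}
    (hT : MeasurableSet T) :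
    ENNReal.ofReal (1 / 2 -
        3 / (32 * σ ^ 2) * (N * (spectralNorm (covMatrix μ) * frobSq (D - D')))) ≤
      sampleLaw N μ σ D T + sampleLaw N μ σ D' Tᶜ := by
  obtain ⟨hm, h1⟩ := sampleLaw_apply N μ σ D hT
  obtain ⟨-, h2⟩ := sampleLaw_apply N μ σ D' hT.compl
  rw [h1, h2, ← lintegral_add_left hm]
  have hint1 : Integrable (fun x : n → ℝ => ∑ i, (D - D').mulVec x i ^ 2) μ :=
    integrable_finsetSum _ fun i _ => (memLp_mulVec hL2 _ i).integrable_sq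
  have hint : Integrable (fun X : Fin N → n → ℝ => ∑ k, ∑ i, (D - D').mulVec (X k) i ^ 2)
      (Measure.pi fun _ : Fin N => μ) :=
    integrable_finsetSum _ fun k _ =>
      integrable_comp_eval (μ := fun _ : Fin N => μ) (i := k) hint1
  have hle : ∫ X : Fin N → n → ℝ, ∑ k, ∑ i, (D - D').mulVec (X k) i ^ 2
      ∂(Measure.pi fun _ : Fin N => μ) ≤ N * (spectralNorm (covMatrix μ) * frobSq (D - D')) := by
    rw [integral_finsetSum _ fun k _ =>
      integrable_comp_eval (μ := fun _ : Fin N => μ) (i := k) hint1]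
    calc _ = ∑ _k : Fin N, ∫ x, ∑ i, (D - D').mulVec x i ^ 2 ∂μ :=
          Finset.sum_congr rfl fun k _ =>
            integral_comp_eval (μ := fun _ : Fin N => μ) (i := k) hint1.aestronglyMeasurable
      _ ≤ _ := by
          rw [Finset.sum_const, Finset.card_univ, Fintype.card_fin, nsmul_eq_mul]
          exact mul_le_mul_of_nonneg_left (integral_sum_mulVec_sq_le hL2 hmean _)
            (Nat.cast_nonneg _)
  have hh := (hint.const_mul (3 / (32 * σ ^ 2)))
  calc _ ≤ ENNReal.ofReal (∫ X : Fin N → n → ℝ, (1 / 2 - 3 / (32 * σ ^ 2) *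
          ∑ k, ∑ i, (D - D').mulVec (X k) i ^ 2) ∂(Measure.pi fun _ : Fin N => μ)) := by
        refine ENNReal.ofReal_le_ofReal ?_
        rw [integral_sub (integrable_const _) hh, integral_const_mul, integral_const]
        simp only [probReal_univ, one_smul]
        gcongr
    _ ≤ ∫⁻ X : Fin N → n → ℝ, ENNReal.ofReal (1 / 2 - 3 / (32 * σ ^ 2) *
          ∑ k, ∑ i, (D - D').mulVec (X k) i ^ 2) ∂(Measure.pi fun _ : Fin N => μ) :=
        ofReal_integral_le_lintegral ((integrable_const _).sub hh)
    _ ≤ _ := by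
        refine lintegral_mono fun X => ?_
        have h := le_noise_add_noise hσ (fun k => D.mulVec (X k)) (fun k => D'.mulVec (X k)) hT
        simp_rw [Matrix.sub_mulVec, Pi.sub_apply]
        refine (ENNReal.ofReal_le_ofReal h).trans ?_
        rw [ENNReal.ofReal_add measureReal_nonneg measureReal_nonneg, ofReal_measureReal,
          ofReal_measureReal]

/-! ### Assouad's lemma for cubes of matrices -/

/-- The Frobenius inner product, as a bilinear form. -/
def frobInner (m n : Type*) [Fintype m] [Fintype n] :
    Matrix m n ℝ →ₗ[ℝ] Matrix m n ℝ →ₗ[ℝ] ℝ :=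
  LinearMap.mk₂ ℝ (fun M N => ∑ i, ∑ j, M i j * N i j)
    (fun M M' N => by simp [add_mul, Finset.sum_add_distrib])
    (fun c M N => by simp [Finset.mul_sum, mul_assoc])
    (fun M N N' => by simp [mul_add, Finset.sum_add_distrib])
    (fun c M N => by simp [Finset.mul_sum, mul_left_comm])

/-- Flipping the `k`-th sign, a permutation of the vertices of the cube. -/
def flipSign {ι : Type*} [DecidableEq ι] (k : ι) : Equiv.Perm (ι → Bool) :=
  Function.Involutive.toPerm (fun s => Function.update s k (!s k)) fun s => by simp

lemma flipSign_apply {ι : Type*} [DecidableEq ι] (k : ι) (s : ι → Bool) :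
    flipSign k s = Function.update s k (!s k) := rfl

section
variable {m n : Type*} [Fintype m] [Fintype n]

lemma frobInner_apply (M N : Matrix m n ℝ) : frobInner m n M N = ∑ i, ∑ j, M i j * N i j := rfl

lemma frobInner_comm (M N : Matrix m n ℝ) : frobInner m n M N = frobInner m n N M := by
  simp_rw [frobInner_apply, mul_comm]

lemma frobInner_self (M : Matrix m n ℝ) : frobInner m n M M = frobSq M := by
  simp_rw [frobInner_apply, frobSq, sq]

lemma frobSq_nonneg (M : Matrix m n ℝ) : 0 ≤ frobSq M :=
  Finset.sum_nonneg fun _ _ => Finset.sum_nonneg fun _ _ => sq_nonneg _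

variable {ι : Type*} [Fintype ι] [DecidableEq ι] {E : ι → Matrix m n ℝ} {δ : ℝ}

lemma frobInner_sum_smul_left (hE : ∀ k l, frobInner m n (E k) (E l) = if k = l then δ else 0)
    (a : ι → ℝ) (l : ι) : frobInner m n (∑ k, a k • E k) (E l) = a l * δ := by
  simp [hE]

lemma frobSq_sub (M N : Matrix m n ℝ) :
    frobSq (M - N) = frobSq M - 2 * frobInner m n M N + frobSq N := by
  rw [← frobInner_self, ← frobInner_self, ← frobInner_self]
  simp only [map_sub, LinearMap.sub_apply, frobInner_comm N M]
  ring

lemma frobSq_sum_smul (hE : ∀ k l, frobInner m n (E k) (E l) = if k = l then δ else 0)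
    (a : ι → ℝ) : frobSq (∑ k, a k • E k) = δ * ∑ k, a k ^ 2 := by
  rw [← frobInner_self, map_sum, Finset.mul_sum]
  refine Finset.sum_congr rfl fun l _ => ?_
  rw [map_smul, frobInner_sum_smul_left hE, smul_eq_mul]
  ring

/-- Bessel's inequality for the residual of `M` against the linear combination `∑ a k • E k` of
a Frobenius-orthogonal family. -/
lemma sum_sq_le_frobSq_sub (hδ : 0 < δ)
    (hE : ∀ k l, frobInner m n (E k) (E l) = if k = l then δ else 0)
    (M : Matrix m n ℝ) (a : ι → ℝ) :
    δ * ∑ k, (frobInner m n M (E k) / δ - a k) ^ 2 ≤ frobSq (M - ∑ k, a k • E k) := by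
  have h0 := frobSq_nonneg (M - ∑ k, (frobInner m n M (E k) / δ) • E k)
  rw [frobSq_sub, frobSq_sum_smul hE] at h0 ⊢
  simp only [map_sum, map_smul, smul_eq_mul] at h0 ⊢
  have h1 : δ * ∑ k, (frobInner m n M (E k) / δ - a k) ^ 2 =
      (∑ k, frobInner m n M (E k) / δ * frobInner m n M (E k)) -
        2 * ∑ k, a k * frobInner m n M (E k) + δ * ∑ k, a k ^ 2 := by
    rw [Finset.mul_sum, Finset.mul_sum, Finset.mul_sum, ← Finset.sum_sub_distrib,
      ← Finset.sum_add_distrib]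
    refine Finset.sum_congr rfl fun k _ => ?_
    field_simp
    ring
  have h2 : δ * ∑ k, (frobInner m n M (E k) / δ) ^ 2 =
      ∑ k, frobInner m n M (E k) / δ * frobInner m n M (E k) := by
    rw [Finset.mul_sum]
    refine Finset.sum_congr rfl fun k _ => ?_
    field_simp
  linarith

/-- The sign `1` or `-1` encoded by a Boolean. -/
def boolSign (b : Bool) : ℝ := if b then 1 else -1

/-- The vertex with signs `s` of the cube with centre `C` and half-edges `E k`. -/
def cubeVertex (C : Matrix m n ℝ) (E : ι → Matrix m n ℝ) (s : ι → Bool) : Matrix m n ℝ :=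
  C + ∑ k, boolSign (s k) • E k

lemma frobSq_cubeVertex_sub_flip
    (hE : ∀ k l, frobInner m n (E k) (E l) = if k = l then δ else 0)
    (C : Matrix m n ℝ) (s : ι → Bool) (k : ι) :
    frobSq (cubeVertex C E s - cubeVertex C E (flipSign k s)) = 4 * δ := by
  have h1 : cubeVertex C E s - cubeVertex C E (flipSign k s) =
      ∑ l, (if l = k then 2 * boolSign (s k) else 0) • E l := by
    rw [cubeVertex, cubeVertex, add_sub_add_left_eq_sub, ← Finset.sum_sub_distrib]
    refine Finset.sum_congr rfl fun l _ => ?_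
    rw [← sub_smul, flipSign_apply]
    congr 1
    by_cases hl : l = k
    · subst hl
      cases h : s l <;> norm_num [boolSign, h]
    · simp [hl]
  rw [h1, frobSq_sum_smul hE]
  have h2 : boolSign (s k) ^ 2 = 1 := by cases s k <;> simp [boolSign]
  simp [ite_pow, mul_pow, h2]
  ring

/-- The values of the `k`-th score `θ` that make its sign a wrong guess for the sign `b`. -/
def wrongSign (b : Bool) : Set ℝ := if b then Set.Iic 0 else Set.Ioi 0

lemma wrongSign_not (b : Bool) : wrongSign (!b) = (wrongSign b)ᶜ := by
  cases b <;> simp [wrongSign]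

lemma measurableSet_wrongSign (b : Bool) : MeasurableSet (wrongSign b) := by
  cases b
  · exact measurableSet_Ioi
  · exact measurableSet_Iic

lemma indicator_wrongSign_le (b : Bool) (θ : ℝ) :
    (wrongSign b).indicator (fun _ => (1 : ℝ)) θ ≤ (θ - boolSign b) ^ 2 := by
  by_cases h : θ ∈ wrongSign b
  · rw [Set.indicator_of_mem h]
    cases b
    · have h' : 0 < θ := h
      rw [show boolSign false = -1 by simp [boolSign]]
      nlinarith
    · have h' : θ ≤ 0 := h
      rw [show boolSign true = 1 by simp [boolSign]]
      nlinarith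
  · rw [Set.indicator_of_notMem h]
    positivity

/-- Assouad's lemma for dictionary estimation. For every estimator, the errors at all vertices of
a cube with Frobenius-orthogonal half-edges of squared length `δ` are bounded below by the errors
in guessing the individual signs, and guessing the `k`-th sign means testing between samples from
two dictionaries at squared distance `4 δ`. -/
theorem le_of_cube (N : ℕ) [DecidableEq n] {μ : Measure (n → ℝ)} [IsProbabilityMeasure μ]
    (hL2 : ∀ i, MemLp (fun x => x i) 2 μ) (hmean : ∀ i, ∫ x, x i ∂μ = 0)
    {σ : ℝ} (hσ : 0 < σ) (hδ : 0 < δ)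
    (hE : ∀ k l, frobInner m n (E k) (E l) = if k = l then δ else 0) (C : Matrix m n ℝ)
    (Dhat : (Fin N → m → ℝ) → Matrix m n ℝ) (hDhat : ∀ i j, Measurable fun Y => Dhat Y i j)
    {W : ℝ≥0∞} (hW : ∀ s, ∫⁻ Y, ENNReal.ofReal (frobSq (Dhat Y - cubeVertex C E s))
      ∂(sampleLaw N μ σ (cubeVertex C E s)) ≤ W) :
    ENNReal.ofReal (Fintype.card ι * δ / 4 *
      (1 - N * spectralNorm (covMatrix μ) / σ ^ 2 * δ)) ≤ W := by
  set q : ℝ := 1 / 2 - 3 / (32 * σ ^ 2) * (N * (spectralNorm (covMatrix μ) * (4 * δ))) with hq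
  set P : (ι → Bool) → Measure (Fin N → m → ℝ) := fun s => sampleLaw N μ σ (cubeVertex C E s)
    with hP
  -- the score whose sign guesses the `k`-th sign
  set θ : ι → (Fin N → m → ℝ) → ℝ := fun k Y => frobInner m n (Dhat Y - C) (E k) / δ with hθ
  have hθm : ∀ k, Measurable (θ k) := by
    intro k
    simp only [hθ, frobInner_apply, Matrix.sub_apply]
    refine Measurable.div_const (Finset.measurable_fun_sum _ fun i _ =>
      Finset.measurable_fun_sum _ fun j _ => ?_) _
    exact ((hDhat i j).sub_const _).mul_const _
  have hmeas : ∀ k b, MeasurableSet (θ k ⁻¹' wrongSign b) :=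
    fun k b => hθm k (measurableSet_wrongSign b)
  have hvertex : ∀ s, ENNReal.ofReal δ * ∑ k, P s (θ k ⁻¹' wrongSign (s k)) ≤ W := by
    intro s
    refine le_trans ?_ (hW s)
    have h1 : ∀ Y, ENNReal.ofReal δ *
        ∑ k, (θ k ⁻¹' wrongSign (s k)).indicator (fun _ => (1 : ℝ≥0∞)) Y ≤
        ENNReal.ofReal (frobSq (Dhat Y - cubeVertex C E s)) := by
      intro Y
      have h2 := sum_sq_le_frobSq_sub hδ hE (Dhat Y - C) fun k => boolSign (s k)
      rw [sub_sub] at h2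
      refine le_trans ?_ (ENNReal.ofReal_le_ofReal h2)
      rw [ENNReal.ofReal_mul hδ.le, ENNReal.ofReal_sum_of_nonneg fun _ _ => sq_nonneg _]
      gcongr with k _
      refine le_trans (le_of_eq ?_)
        (ENNReal.ofReal_le_ofReal (indicator_wrongSign_le (s k) (θ k Y)))
      by_cases h : θ k Y ∈ wrongSign (s k)
      · rw [Set.indicator_of_mem h, Set.indicator_of_mem (Set.mem_preimage.2 h), ENNReal.ofReal_one]
      · rw [Set.indicator_of_notMem h, Set.indicator_of_notMem (fun h' => h (Set.mem_preimage.1 h')),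
          ENNReal.ofReal_zero]
    refine le_trans (le_of_eq ?_) (lintegral_mono h1)
    have hind : ∀ k, Measurable
        ((θ k ⁻¹' wrongSign (s k)).indicator fun _ : Fin N → m → ℝ => (1 : ℝ≥0∞)) :=
      fun k => measurable_const.indicator (hmeas k _)
    rw [lintegral_const_mul _ (Finset.measurable_fun_sum _ fun k _ => hind k),
      lintegral_finsetSum _ fun k _ => hind k]
    congr 1
    refine Finset.sum_congr rfl fun k _ => ?_
    rw [lintegral_indicator (hmeas k _), setLIntegral_one]
  have hpair : ∀ k s, ENNReal.ofReal q ≤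
      P s (θ k ⁻¹' wrongSign (s k)) +
        P (flipSign k s) (θ k ⁻¹' wrongSign (flipSign k s k)) := by
    intro k s
    have h := le_sampleLaw_add_sampleLaw N hL2 hmean hσ (cubeVertex C E s)
      (cubeVertex C E (flipSign k s)) (hmeas k (s k))
    rw [frobSq_cubeVertex_sub_flip hE, ← Set.preimage_compl, ← wrongSign_not] at h
    rwa [flipSign_apply, Function.update_self, ← flipSign_apply]
  have hcoord : ∀ k, (Fintype.card (ι → Bool) : ℝ≥0∞) * ENNReal.ofReal q ≤
      2 * ∑ s, P s (θ k ⁻¹' wrongSign (s k)) := by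
    intro k
    have h1 : ∑ s, P (flipSign k s) (θ k ⁻¹' wrongSign (flipSign k s k)) =
        ∑ s, P s (θ k ⁻¹' wrongSign (s k)) :=
      Equiv.sum_comp (flipSign k) fun s => P s (θ k ⁻¹' wrongSign (s k))
    have h2 := Finset.sum_le_sum fun s (_ : s ∈ Finset.univ) => hpair k s
    rw [Finset.sum_add_distrib, h1, ← two_mul, Finset.sum_const, nsmul_eq_mul] at h2
    exact h2
  set c : ℝ≥0∞ := (Fintype.card (ι → Bool) : ℝ≥0∞) with hc
  have hc0 : c ≠ 0 := by simp [hc]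
  have hct : c ≠ ∞ := ENNReal.natCast_ne_top _
  have htotal : c * (ENNReal.ofReal δ * (Fintype.card ι * ENNReal.ofReal q)) ≤ c * (2 * W) := by
    calc _ = ENNReal.ofReal δ * ∑ _k : ι, c * ENNReal.ofReal q := by
          rw [Finset.sum_const, nsmul_eq_mul, Finset.card_univ]; ring
      _ ≤ ENNReal.ofReal δ * ∑ k, 2 * ∑ s, P s (θ k ⁻¹' wrongSign (s k)) := by
          refine mul_le_mul_right (Finset.sum_le_sum fun k _ => hcoord k) _
      _ = 2 * ∑ s, ENNReal.ofReal δ * ∑ k, P s (θ k ⁻¹' wrongSign (s k)) := by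
          rw [← Finset.mul_sum, Finset.sum_comm, ← Finset.mul_sum]; ring
      _ ≤ 2 * ∑ _s : ι → Bool, W := by
          gcongr with s _
          exact hvertex s
      _ = c * (2 * W) := by
          rw [Finset.sum_const, nsmul_eq_mul, Finset.card_univ]; ring
  rw [ENNReal.mul_le_mul_iff_right hc0 hct] at htotal
  have hnorm : 0 ≤ spectralNorm (covMatrix μ) := norm_nonneg _
  have hle : Fintype.card ι * δ / 4 * (1 - N * spectralNorm (covMatrix μ) / σ ^ 2 * δ) ≤
      δ * (Fintype.card ι * q) / 2 := by
    have h3 : 0 ≤ N * spectralNorm (covMatrix μ) / σ ^ 2 * δ := by positivity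
    have h4 : q = 1 / 2 - 3 / 8 * (N * spectralNorm (covMatrix μ) / σ ^ 2 * δ) := by
      rw [hq]; field_simp; ring
    have h5 : 0 ≤ (Fintype.card ι : ℝ) * δ := by positivity
    rw [h4]
    nlinarith [mul_nonneg h5 h3]
  refine (ENNReal.ofReal_le_ofReal hle).trans ?_
  rw [ENNReal.ofReal_div_of_pos two_pos, ENNReal.ofReal_mul hδ.le,
    ENNReal.ofReal_mul (Nat.cast_nonneg _), ENNReal.ofReal_natCast, ENNReal.ofReal_ofNat]
  exact ENNReal.div_le_of_le_mul' htotal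

end

/-! ### Cubes of Kronecker-structured dictionaries -/

lemma exists_orthonormal_perp {m : ℕ} (a : Fin m → ℝ) (ha : ∑ i, a i ^ 2 = 1) :
    ∃ u : Fin (m - 1) → Fin m → ℝ, (∀ k l, ∑ i, u k i * u l i = if k = l then 1 else 0) ∧
      ∀ k, ∑ i, a i * u k i = 0 := by
  obtain _ | n := m
  · simp at ha
  have : Fact (Module.finrank ℝ (EuclideanSpace ℝ (Fin (n + 1))) = n + 1) := ⟨by simp⟩
  have hv : (WithLp.toLp 2 a : EuclideanSpace ℝ (Fin (n + 1))) ≠ 0 := by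
    intro h
    have : a = 0 := by simpa using h
    simp [this] at ha
  let b := OrthonormalBasis.fromOrthogonalSpanSingleton (𝕜 := ℝ) n hv
  refine ⟨fun k i => (b k : EuclideanSpace ℝ (Fin (n + 1))) i, fun k l => ?_, fun k => ?_⟩
  · have h := orthonormal_iff_ite.1 b.orthonormal k l
    rw [← h, Submodule.coe_inner, PiLp.inner_apply]
    exact Finset.sum_congr rfl fun i _ => by simp [mul_comm]
  · have h := Submodule.mem_orthogonal_singleton_iff_inner_right.1 (b k).2
    rw [← h, PiLp.inner_apply]
    exact Finset.sum_congr rfl fun i _ => by simp [mul_comm]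

lemma sum_sq_of_orthonormal_perp {ι κ : Type*} [Fintype ι] [Fintype κ] [DecidableEq κ]
    {a : ι → ℝ} (ha : ∑ i, a i ^ 2 = 1) {u : κ → ι → ℝ}
    (hu : ∀ k l, ∑ i, u k i * u l i = if k = l then 1 else 0) (hau : ∀ k, ∑ i, a i * u k i = 0)
    {t : κ → ℝ} (ht : ∀ k, t k ^ 2 = 1) (α γ : ℝ) :
    ∑ i, (α * a i + ∑ k, t k * (γ * u k i)) ^ 2 = α ^ 2 + γ ^ 2 * Fintype.card κ := by
  have h1 : ∀ i, (α * a i + ∑ k, t k * (γ * u k i)) ^ 2 = α ^ 2 * a i ^ 2 +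
      (∑ k, 2 * α * γ * t k * (a i * u k i) +
        ∑ k, ∑ l, γ ^ 2 * (t k * t l) * (u k i * u l i)) := by
    intro i
    have h2 : (∑ k, t k * (γ * u k i)) ^ 2 =
        ∑ k, ∑ l, γ ^ 2 * (t k * t l) * (u k i * u l i) := by
      rw [sq, Finset.sum_mul_sum]
      exact Finset.sum_congr rfl fun k _ => Finset.sum_congr rfl fun l _ => by ring
    have h3 : ∑ k, 2 * α * γ * t k * (a i * u k i) =
        2 * (α * a i) * ∑ k, t k * (γ * u k i) := by
      rw [Finset.mul_sum]
      exact Finset.sum_congr rfl fun k _ => by ring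
    rw [← h2, h3]
    ring
  simp_rw [h1]
  rw [Finset.sum_add_distrib, Finset.sum_add_distrib, ← Finset.mul_sum, ha, Finset.sum_comm,
    Finset.sum_comm (s := Finset.univ) (t := (Finset.univ : Finset κ))
      (f := fun i k => ∑ l, γ ^ 2 * (t k * t l) * (u k i * u l i))]
  have h4 : ∀ k, ∑ i, ∑ l, γ ^ 2 * (t k * t l) * (u k i * u l i) = γ ^ 2 := by
    intro k
    rw [Finset.sum_comm]
    simp_rw [← Finset.mul_sum, hu]
    simp [← sq, ht]
  simp_rw [h4, ← Finset.mul_sum, hau]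
  simp [mul_comm]

/-- Around every matrix with unit columns there is a cube of matrices with unit columns: each
column `a` is replaced by `√(1 - ε) a + √(ε / (m - 1)) ∑ k, ± u k`, for an orthonormal basis `u`
of the orthogonal complement of `a`. -/
lemma exists_cube_of_unit_columns {m p : ℕ} (hm : 2 ≤ m) (A : Matrix (Fin m) (Fin p) ℝ)
    (hA : ∀ j, ∑ i, A i j ^ 2 = 1) {ε : ℝ} (hε0 : 0 < ε) (hε1 : ε ≤ 1) :
    ∃ (C : Matrix (Fin m) (Fin p) ℝ) (E : Fin p × Fin (m - 1) → Matrix (Fin m) (Fin p) ℝ),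
      (∀ k l, frobInner (Fin m) (Fin p) (E k) (E l) = if k = l then ε / ((m : ℝ) - 1) else 0) ∧
      ∀ s, (∀ j, ∑ i, cubeVertex C E s i j ^ 2 = 1) ∧
        frobSq (cubeVertex C E s - A) ≤ 2 * p * ε := by
  choose u hu hau using fun j => exists_orthonormal_perp (fun i => A i j) (hA j)
  have hm1 : (0 : ℝ) < (m : ℝ) - 1 := by
    have : (2 : ℝ) ≤ m := by exact_mod_cast hm
    linarith
  have hcard : (Fintype.card (Fin (m - 1)) : ℝ) = (m : ℝ) - 1 := by
    rw [Fintype.card_fin, Nat.cast_sub (by omega), Nat.cast_one]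
  set γ : ℝ := √(ε / ((m : ℝ) - 1)) with hγ
  have hγ2 : γ ^ 2 = ε / ((m : ℝ) - 1) := Real.sq_sqrt (by positivity)
  set α : ℝ := √(1 - ε) with hα
  have hα2 : α ^ 2 = 1 - ε := Real.sq_sqrt (by linarith)
  have hα0 : 0 ≤ α := Real.sqrt_nonneg _
  let E : Fin p × Fin (m - 1) → Matrix (Fin m) (Fin p) ℝ :=
    fun k => Matrix.of fun i j => if j = k.1 then γ * u k.1 k.2 i else 0
  have hsign : ∀ (s : Fin p × Fin (m - 1) → Bool) k, boolSign (s k) ^ 2 = 1 := by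
    intro s k
    cases s k <;> simp [boolSign]
  have hentry : ∀ (s : Fin p × Fin (m - 1) → Bool) i j, (∑ k, boolSign (s k) • E k) i j =
      ∑ k, boolSign (s (j, k)) * (γ * u j k i) := by
    intro s i j
    simp only [Matrix.sum_apply, Matrix.smul_apply, smul_eq_mul, E, Matrix.of_apply,
      Fintype.sum_prod_type, mul_ite, mul_zero]
    rw [Finset.sum_eq_single j]
    · simp
    · intro j' _ hj'
      simp [Ne.symm hj']
    · simp
  refine ⟨α • A, E, fun k l => ?_, fun s => ⟨fun j => ?_, ?_⟩⟩
  · obtain ⟨j, k⟩ := k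
    obtain ⟨j', l⟩ := l
    have h1 : ∀ i j'', E (j, k) i j'' * E (j', l) i j'' =
        if j'' = j then (if j = j' then γ ^ 2 * (u j k i * u j' l i) else 0) else 0 := by
      intro i j''
      simp only [E, Matrix.of_apply]
      by_cases h : j'' = j
      · subst h
        by_cases h' : j'' = j' <;> simp [h']
        ring
      · simp [h]
    simp_rw [frobInner_apply, h1]
    by_cases h : j = j'
    · subst h
      simp [← Finset.mul_sum, hu, hγ2]
    · simp [h]
  · have h := sum_sq_of_orthonormal_perp (hA j) (hu j) (hau j) (fun k => hsign s (j, k)) α γ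
    simp only [cubeVertex, Matrix.add_apply, hentry, Matrix.smul_apply, smul_eq_mul]
    rw [h, hα2, hγ2, hcard]
    field_simp
    ring
  · have hcol : ∀ j, ∑ i, (cubeVertex (α • A) E s - A) i j ^ 2 = (α - 1) ^ 2 + ε := by
      intro j
      have h := sum_sq_of_orthonormal_perp (hA j) (hu j) (hau j) (fun k => hsign s (j, k)) (α - 1) γ
      rw [hγ2, hcard, div_mul_cancel₀ _ hm1.ne'] at h
      rw [← h]
      refine Finset.sum_congr rfl fun i _ => ?_
      simp only [cubeVertex, Matrix.add_apply, Matrix.sub_apply, hentry, Matrix.smul_apply,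
        smul_eq_mul]
      ring
    rw [frobSq, Finset.sum_comm]
    simp_rw [hcol]
    rw [Finset.sum_const, Finset.card_univ, Fintype.card_fin, nsmul_eq_mul, mul_comm (2 : ℝ),
      mul_assoc]
    refine mul_le_mul_of_nonneg_left ?_ (Nat.cast_nonneg p)
    -- `(1 - α)² + ε = 2 (1 - α)`, and `1 - ε = α² ≤ α`.
    have hα1 : α ≤ 1 := by nlinarith
    nlinarith

lemma frobInner_kronecker {m₁ m₂ p₁ p₂ : Type*} [Fintype m₁] [Fintype m₂] [Fintype p₁]
    [Fintype p₂] (A A' : Matrix m₁ p₁ ℝ) (B B' : Matrix m₂ p₂ ℝ) :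
    frobInner (m₁ × m₂) (p₁ × p₂) (A ⊗ₖ B) (A' ⊗ₖ B') =
      frobInner m₁ p₁ A A' * frobInner m₂ p₂ B B' := by
  simp_rw [frobInner_apply, Fintype.sum_prod_type, Matrix.kroneckerMap_apply]
  rw [Finset.sum_mul_sum]
  refine Finset.sum_congr rfl fun i _ => Finset.sum_congr rfl fun i' _ => ?_
  rw [Finset.sum_mul_sum]
  exact Finset.sum_congr rfl fun j _ => Finset.sum_congr rfl fun j' _ => by ring

lemma frobSq_kronecker {m₁ m₂ p₁ p₂ : Type*} [Fintype m₁] [Fintype m₂] [Fintype p₁]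
    [Fintype p₂] (A : Matrix m₁ p₁ ℝ) (B : Matrix m₂ p₂ ℝ) :
    frobSq (A ⊗ₖ B) = frobSq A * frobSq B := by
  simp_rw [← frobInner_self, frobInner_kronecker]

lemma sum_sq_kronecker {m₁ m₂ p₁ p₂ : Type*} [Fintype m₁] [Fintype m₂]
    (A : Matrix m₁ p₁ ℝ) (B : Matrix m₂ p₂ ℝ) (j : p₁ × p₂) :
    ∑ i, (A ⊗ₖ B) i j ^ 2 = (∑ i, A i j.1 ^ 2) * ∑ i, B i j.2 ^ 2 := by
  simp_rw [Fintype.sum_prod_type, Matrix.kroneckerMap_apply]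
  rw [Finset.sum_mul_sum]
  exact Finset.sum_congr rfl fun i _ => Finset.sum_congr rfl fun i' _ => by ring

lemma frobSq_of_unit_columns {m p : ℕ} {A : Matrix (Fin m) (Fin p) ℝ}
    (hA : ∀ j, ∑ i, A i j ^ 2 = 1) : frobSq A = p := by
  rw [frobSq, Finset.sum_comm]
  simp [hA]

lemma cubeVertex_kronecker_left {ι m₁ m₂ p₁ p₂ : Type*} [Fintype ι]
    (C : Matrix m₁ p₁ ℝ) (E : ι → Matrix m₁ p₁ ℝ) (s : ι → Bool) (B : Matrix m₂ p₂ ℝ) :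
    cubeVertex (C ⊗ₖ B) (fun k => E k ⊗ₖ B) s = cubeVertex C E s ⊗ₖ B := by
  ext i j
  simp [cubeVertex, Matrix.sum_apply, add_mul, Finset.sum_mul, mul_assoc]

lemma cubeVertex_kronecker_right {ι m₁ m₂ p₁ p₂ : Type*} [Fintype ι]
    (C : Matrix m₂ p₂ ℝ) (E : ι → Matrix m₂ p₂ ℝ) (s : ι → Bool) (A : Matrix m₁ p₁ ℝ) :
    cubeVertex (A ⊗ₖ C) (fun k => A ⊗ₖ E k) s = A ⊗ₖ cubeVertex C E s := by
  ext i j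
  simp [cubeVertex, Matrix.sum_apply, mul_add, Finset.mul_sum, mul_left_comm]

/-- The two factors of a Kronecker-structured dictionary can be rescaled to have unit columns,
because the column norms of each factor are all equal. -/
lemma exists_unit_factors {m₁ m₂ p₁ p₂ : ℕ} (hp₁ : 0 < p₁) (hp₂ : 0 < p₂)
    {D : Matrix (Fin m₁ × Fin m₂) (Fin p₁ × Fin p₂) ℝ} (hD : D ∈ dictionaries m₁ m₂ p₁ p₂) :
    ∃ (A : Matrix (Fin m₁) (Fin p₁) ℝ) (B : Matrix (Fin m₂) (Fin p₂) ℝ),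
      (∀ j, ∑ i, A i j ^ 2 = 1) ∧ (∀ j, ∑ i, B i j ^ 2 = 1) ∧ D = A ⊗ₖ B := by
  obtain ⟨hcol, A, B, rfl⟩ := hD
  simp_rw [sum_sq_kronecker] at hcol
  set a := ∑ i, A i ⟨0, hp₁⟩ ^ 2 with ha
  set b := ∑ i, B i ⟨0, hp₂⟩ ^ 2 with hb
  have hab : a * b = 1 := hcol (⟨0, hp₁⟩, ⟨0, hp₂⟩)
  have ha0 : 0 ≤ a := Finset.sum_nonneg fun _ _ => sq_nonneg _
  have hb0 : 0 ≤ b := Finset.sum_nonneg fun _ _ => sq_nonneg _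
  have hs : √b * √a = 1 := by rw [← Real.sqrt_mul hb0, mul_comm, hab, Real.sqrt_one]
  refine ⟨√b • A, √a • B, fun j => ?_, fun j => ?_, ?_⟩
  · have h := hcol (j, ⟨0, hp₂⟩)
    simp_rw [Matrix.smul_apply, smul_eq_mul, mul_pow, Real.sq_sqrt hb0, ← Finset.mul_sum]
    rw [mul_comm]
    exact h
  · have h := hcol (⟨0, hp₁⟩, j)
    simp_rw [Matrix.smul_apply, smul_eq_mul, mul_pow, Real.sq_sqrt ha0, ← Finset.mul_sum]
    exact h
  · rw [Matrix.smul_kronecker, Matrix.kronecker_smul, smul_smul, hs, one_smul]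

/-! ### Lower bounds on the minimax risk -/

section
variable {m₁ m₂ p₁ p₂ N : ℕ} {D₀ : Matrix (Fin m₁ × Fin m₂) (Fin p₁ × Fin p₂) ℝ} {r σ ε : ℝ}
  {μ : Measure (Fin p₁ × Fin p₂ → ℝ)} [IsProbabilityMeasure μ]

lemma le_minimaxRisk_of_cube {ι : Type*} [Fintype ι] [DecidableEq ι]
    (hL2 : ∀ i, MemLp (fun x => x i) 2 μ) (hmean : ∀ i, ∫ x, x i ∂μ = 0) (hσ : 0 < σ)
    {δ : ℝ} (hδ : 0 < δ) {C : Matrix (Fin m₁ × Fin m₂) (Fin p₁ × Fin p₂) ℝ}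
    {E : ι → Matrix (Fin m₁ × Fin m₂) (Fin p₁ × Fin p₂) ℝ}
    (hE : ∀ k l, frobInner _ _ (E k) (E l) = if k = l then δ else 0)
    (hmem : ∀ s, cubeVertex C E s ∈ neighborhood D₀ r) :
    ENNReal.ofReal (Fintype.card ι * δ / 4 *
      (1 - N * spectralNorm (covMatrix μ) / σ ^ 2 * δ)) ≤ minimaxRisk N μ σ D₀ r := by
  refine le_iInf₂ fun Dhat hDhat => ?_
  exact le_of_cube N hL2 hmean hσ hδ hE C Dhat hDhat fun s =>
    le_iSup₂ (f := fun D (_ : D ∈ neighborhood D₀ r) =>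
      ∫⁻ Y, ENNReal.ofReal (frobSq (Dhat Y - D)) ∂(sampleLaw N μ σ D)) _ (hmem s)

/-- The bound from perturbing the left factor only, in `p₁ (m₁ - 1)` directions. -/
lemma le_minimaxRisk_left (hp₁ : 0 < p₁) (hp₂ : 0 < p₂) (hD₀ : D₀ ∈ dictionaries m₁ m₂ p₁ p₂)
    (hL2 : ∀ i, MemLp (fun x => x i) 2 μ) (hmean : ∀ i, ∫ x, x i ∂μ = 0) (hσ : 0 < σ)
    (hm : 2 ≤ m₁) (hε0 : 0 < ε) (hε1 : ε ≤ 1) (hεr : 2 * (p₁ * p₂) * ε < r ^ 2) :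
    ENNReal.ofReal (p₁ * p₂ * ε / 4 * (1 - N * spectralNorm (covMatrix μ) / σ ^ 2 *
      (p₁ * p₂ * ε / (p₁ * ((m₁ : ℝ) - 1))))) ≤ minimaxRisk N μ σ D₀ r := by
  obtain ⟨A, B, hA, hB, rfl⟩ := exists_unit_factors hp₁ hp₂ hD₀
  obtain ⟨C, E, hE, hs⟩ := exists_cube_of_unit_columns hm A hA hε0 hε1
  have hp₁' : (0 : ℝ) < p₁ := by exact_mod_cast hp₁
  have hp₂' : (0 : ℝ) < p₂ := by exact_mod_cast hp₂
  have hm1 : (0 : ℝ) < (m₁ : ℝ) - 1 := by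
    have : (2 : ℝ) ≤ m₁ := by exact_mod_cast hm
    linarith
  have hδ : 0 < ε / ((m₁ : ℝ) - 1) * p₂ := by positivity
  have h := le_minimaxRisk_of_cube (N := N) (D₀ := A ⊗ₖ B) (r := r) hL2 hmean hσ hδ
    (C := C ⊗ₖ B) (E := fun k => E k ⊗ₖ B)
    (fun k l => by
      rw [frobInner_kronecker, hE, frobInner_self, frobSq_of_unit_columns hB, ite_mul, zero_mul])
    (fun s => by
      rw [cubeVertex_kronecker_left]
      refine ⟨⟨fun j => ?_, _, _, rfl⟩, ?_⟩
      · rw [sum_sq_kronecker, (hs s).1, hB, one_mul]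
      · have hsub : cubeVertex C E s ⊗ₖ B - A ⊗ₖ B = (cubeVertex C E s - A) ⊗ₖ B := by
          ext i j
          simp [sub_mul]
        rw [hsub, frobSq_kronecker, frobSq_of_unit_columns hB]
        nlinarith [(hs s).2])
  convert h using 2
  rw [Fintype.card_prod, Fintype.card_fin, Fintype.card_fin, Nat.cast_mul,
    Nat.cast_sub (by omega), Nat.cast_one]
  field_simp

/-- The bound from perturbing the right factor only, in `p₂ (m₂ - 1)` directions. -/
lemma le_minimaxRisk_right (hp₁ : 0 < p₁) (hp₂ : 0 < p₂) (hD₀ : D₀ ∈ dictionaries m₁ m₂ p₁ p₂)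
    (hL2 : ∀ i, MemLp (fun x => x i) 2 μ) (hmean : ∀ i, ∫ x, x i ∂μ = 0) (hσ : 0 < σ)
    (hm : 2 ≤ m₂) (hε0 : 0 < ε) (hε1 : ε ≤ 1) (hεr : 2 * (p₁ * p₂) * ε < r ^ 2) :
    ENNReal.ofReal (p₁ * p₂ * ε / 4 * (1 - N * spectralNorm (covMatrix μ) / σ ^ 2 *
      (p₁ * p₂ * ε / (p₂ * ((m₂ : ℝ) - 1))))) ≤ minimaxRisk N μ σ D₀ r := by
  obtain ⟨A, B, hA, hB, rfl⟩ := exists_unit_factors hp₁ hp₂ hD₀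
  obtain ⟨C, E, hE, hs⟩ := exists_cube_of_unit_columns hm B hB hε0 hε1
  have hp₁' : (0 : ℝ) < p₁ := by exact_mod_cast hp₁
  have hp₂' : (0 : ℝ) < p₂ := by exact_mod_cast hp₂
  have hm1 : (0 : ℝ) < (m₂ : ℝ) - 1 := by
    have : (2 : ℝ) ≤ m₂ := by exact_mod_cast hm
    linarith
  have hδ : 0 < p₁ * (ε / ((m₂ : ℝ) - 1)) := by positivity
  have h := le_minimaxRisk_of_cube (N := N) (D₀ := A ⊗ₖ B) (r := r) hL2 hmean hσ hδ
    (C := A ⊗ₖ C) (E := fun k => A ⊗ₖ E k)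
    (fun k l => by
      rw [frobInner_kronecker, hE, frobInner_self, frobSq_of_unit_columns hA, mul_ite, mul_zero])
    (fun s => by
      rw [cubeVertex_kronecker_right]
      refine ⟨⟨fun j => ?_, _, _, rfl⟩, ?_⟩
      · rw [sum_sq_kronecker, (hs s).1, hA, one_mul]
      · have hsub : A ⊗ₖ cubeVertex C E s - A ⊗ₖ B = A ⊗ₖ (cubeVertex C E s - B) := by
          ext i j
          simp [mul_sub]
        rw [hsub, frobSq_kronecker, frobSq_of_unit_columns hA]
        nlinarith [(hs s).2])
  convert h using 2
  rw [Fintype.card_prod, Fintype.card_fin, Fintype.card_fin, Nat.cast_mul,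
    Nat.cast_sub (by omega), Nat.cast_one]
  field_simp

end

/-- Choice of the radius `ε` of the cube. The largest admissible radius `M` would contradict the
upper bound on `R` unless `κ p M / n ≥ t`; hence the radius with `κ p ε / n = t / 2` is
admissible. -/
lemma ofReal_le_of_forall_radius {R : ℝ≥0∞} {p M n κ t S c : ℝ} (hp : 0 < p) (hM : 0 < M)
    (hn : 0 < n) (hκ : 0 < κ) (ht0 : 0 < t) (ht1 : t < 1) (hc : 0 < c) (hct : c ≤ t / 4)
    (hS : S ≤ 2 * n)
    (h : ∀ ε, 0 < ε → ε ≤ M → ENNReal.ofReal (p * ε / 4 * (1 - κ * (p * ε / n))) ≤ R)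
    (hR : R ≤ ENNReal.ofReal (2 * p * (1 - t) / 8 * M)) :
    ENNReal.ofReal ((1 - t) / (32 * κ) * (c * S - 3)) ≤ R := by
  have h1t : 0 < 1 - t := by linarith
  have hmax : t ≤ κ * (p * M / n) := by
    have h1 := (h M hM le_rfl).trans hR
    rw [ENNReal.ofReal_le_ofReal_iff (by positivity)] at h1
    have h2 : 0 < p * M / 4 := by positivity
    nlinarith
  have hεM : t * n / (2 * κ * p) ≤ M := by
    rw [div_le_iff₀ (by positivity)]
    have h3 : t * n ≤ κ * (p * M) := by
      rw [← mul_div_assoc, le_div_iff₀ hn] at hmax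
      exact hmax
    have : 0 < κ * (p * M) := by positivity
    nlinarith
  refine le_trans (ENNReal.ofReal_le_ofReal ?_) (h (t * n / (2 * κ * p)) (by positivity) hεM)
  have h4 : p * (t * n / (2 * κ * p)) / 4 * (1 - κ * (p * (t * n / (2 * κ * p)) / n)) =
      1 / (32 * κ) * (4 * t * n * (1 - t / 2)) := by
    field_simp
    ring
  rw [h4, div_eq_mul_one_div, mul_comm (1 - t), mul_assoc]
  refine mul_le_mul_of_nonneg_left ?_ (by positivity)
  have h5 : c * S ≤ t / 4 * (2 * n) :=
    (mul_le_mul_of_nonneg_left hS hc.le).trans (mul_le_mul_of_nonneg_right hct (by positivity))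
  have h6 : 0 < t * n := by positivity
  nlinarith [mul_pos h6 h1t]

lemma spectralNorm_pos {n : Type*} [Fintype n] [DecidableEq n] {M : Matrix n n ℝ} (hM : M ≠ 0) :
    0 < spectralNorm M := by
  rw [spectralNorm, norm_pos_iff]
  exact (map_ne_zero_iff _ (Matrix.toEuclideanCLM (n := n) (𝕜 := ℝ)).injective).2 hM

end KSDict

theorem theorem1 (m₁ m₂ p₁ p₂ N : ℕ) (hN : 0 < N)
    (D₀ : Matrix (Fin m₁ × Fin m₂) (Fin p₁ × Fin p₂) ℝ)
    (hD₀ : D₀ ∈ KSDict.dictionaries m₁ m₂ p₁ p₂)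
    (r : ℝ) (hr : 0 < r) (σ : ℝ) (hσ : 0 < σ)
    (μ : Measure (Fin p₁ × Fin p₂ → ℝ)) [IsProbabilityMeasure μ]
    (hL2 : ∀ i, MemLp (fun x => x i) 2 μ)
    (hmean : ∀ i, ∫ x, x i ∂μ = 0)
    (hcov : KSDict.covMatrix μ ≠ 0)
    (t : ℝ) (ht0 : 0 < t) (ht1 : t < 1)
    (c₁ : ℝ) (hc0 : 0 < c₁) (hc1 : c₁ < t / (8 * Real.log 2))
    (p : ℝ) (hp : p = (p₁ : ℝ) * (p₂ : ℝ))
    (C₁ : ℝ) (hC₁ : C₁ = (1 - t) * p / (32 * r ^ 2))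
    (hrisk : KSDict.minimaxRisk N μ σ D₀ r ≤
      ENNReal.ofReal (2 * p * (1 - t) / 8 * min 1 (r ^ 2 / (4 * p)))) :
    ENNReal.ofReal
        (C₁ * r ^ 2 * σ ^ 2 / (N * p * KSDict.spectralNorm (KSDict.covMatrix μ)) *
          (c₁ * (p₁ * ((m₁ : ℝ) - 1) + p₂ * ((m₂ : ℝ) - 1)) - 3)) ≤
      KSDict.minimaxRisk N μ σ D₀ r := by
  have hp₁ : 0 < p₁ := by
    rcases Nat.eq_zero_or_pos p₁ with h | h
    · subst h
      exact absurd (Matrix.ext fun i _ => i.1.elim0) hcov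
    · exact h
  have hp₂ : 0 < p₂ := by
    rcases Nat.eq_zero_or_pos p₂ with h | h
    · subst h
      exact absurd (Matrix.ext fun i _ => i.2.elim0) hcov
    · exact h
  have hp₁' : (0 : ℝ) < p₁ := by exact_mod_cast hp₁
  have hp₂' : (0 : ℝ) < p₂ := by exact_mod_cast hp₂
  have hN' : (0 : ℝ) < N := by exact_mod_cast hN
  have hp0 : 0 < p := hp ▸ mul_pos hp₁' hp₂'
  have hnorm := KSDict.spectralNorm_pos hcov
  set κ : ℝ := N * KSDict.spectralNorm (KSDict.covMatrix μ) / σ ^ 2 with hκ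
  have hκ0 : 0 < κ := by positivity
  set M : ℝ := min 1 (r ^ 2 / (4 * p)) with hM
  have hM0 : 0 < M := lt_min one_pos (by positivity)
  have hrad : ∀ ε, 0 < ε → ε ≤ M → ε ≤ 1 ∧ 2 * (p₁ * p₂) * ε < r ^ 2 := by
    intro ε hε0 hε
    refine ⟨hε.trans (min_le_left _ _), ?_⟩
    have h1 : ε ≤ r ^ 2 / (4 * p) := hε.trans (min_le_right _ _)
    rw [le_div_iff₀ (by positivity)] at h1
    rw [← hp]
    nlinarith [pow_pos hr 2]
  -- the only use of `log 2`: it exceeds `1 / 2`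
  have hc : c₁ ≤ t / 4 := by
    refine hc1.le.trans (div_le_div_of_nonneg_left ht0.le (by norm_num) ?_)
    linarith [Real.log_two_gt_d9]
  have hconst : C₁ * r ^ 2 * σ ^ 2 / (N * p * KSDict.spectralNorm (KSDict.covMatrix μ)) =
      (1 - t) / (32 * κ) := by
    rw [hC₁, hκ]
    field_simp
  rw [hconst]
  obtain ⟨j₁⟩ : Nonempty (Fin p₁) := ⟨⟨0, hp₁⟩⟩
  obtain ⟨j₂⟩ : Nonempty (Fin p₂) := ⟨⟨0, hp₂⟩⟩
  obtain ⟨A, B, hA, hB, -⟩ := KSDict.exists_unit_factors hp₁ hp₂ hD₀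
  have hm₁ : 1 ≤ m₁ := by
    rcases Nat.eq_zero_or_pos m₁ with h | h
    · subst h
      simpa using hA j₁
    · exact h
  have hm₂ : 1 ≤ m₂ := by
    rcases Nat.eq_zero_or_pos m₂ with h | h
    · subst h
      simpa using hB j₂
    · exact h
  have hm₁' : (1 : ℝ) ≤ m₁ := by exact_mod_cast hm₁
  have hm₂' : (1 : ℝ) ≤ m₂ := by exact_mod_cast hm₂
  have hn₁ : 0 ≤ p₁ * ((m₁ : ℝ) - 1) := mul_nonneg hp₁'.le (by linarith)
  have hn₂ : 0 ≤ p₂ * ((m₂ : ℝ) - 1) := mul_nonneg hp₂'.le (by linarith)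
  -- perturb only the factor with more degrees of freedom
  rcases le_total (p₂ * ((m₂ : ℝ) - 1)) (p₁ * ((m₁ : ℝ) - 1)) with hle | hle
  · rcases hn₁.eq_or_lt with h0 | hpos
    · have h2 : p₂ * ((m₂ : ℝ) - 1) = 0 := le_antisymm (h0 ▸ hle) hn₂
      rw [← h0, h2, ENNReal.ofReal_of_nonpos]
      · exact zero_le
      · refine mul_nonpos_of_nonneg_of_nonpos (div_nonneg (by linarith) (by positivity)) ?_
        norm_num
    · have hm : 2 ≤ m₁ := by
        have : (1 : ℝ) < m₁ := by
          have := (mul_pos_iff_of_pos_left hp₁').1 hpos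
          linarith
        exact_mod_cast this
      refine KSDict.ofReal_le_of_forall_radius hp0 hM0 hpos hκ0 ht0 ht1 hc0 hc (by linarith)
        (fun ε hε0 hε => ?_) hrisk
      rw [hp]
      exact KSDict.le_minimaxRisk_left hp₁ hp₂ hD₀ hL2 hmean hσ hm hε0 (hrad ε hε0 hε).1
        (hrad ε hε0 hε).2
  · rcases hn₂.eq_or_lt with h0 | hpos
    · have h2 : p₁ * ((m₁ : ℝ) - 1) = 0 := le_antisymm (h0 ▸ hle) hn₁
      rw [← h0, h2, ENNReal.ofReal_of_nonpos]
      · exact zero_le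
      · refine mul_nonpos_of_nonneg_of_nonpos (div_nonneg (by linarith) (by positivity)) ?_
        norm_num
    · have hm : 2 ≤ m₂ := by
        have : (1 : ℝ) < m₂ := by
          have := (mul_pos_iff_of_pos_left hp₂').1 hpos
          linarith
        exact_mod_cast this
      refine KSDict.ofReal_le_of_forall_radius hp0 hM0 hpos hκ0 ht0 ht1 hc0 hc (by linarith)
        (fun ε hε0 hε => ?_) hrisk
      rw [hp]
      exact KSDict.le_minimaxRisk_right hp₁ hp₂ hD₀ hL2 hmean hσ hm hε0 (hrad ε hε0 hε).1
        (hrad ε hε0 hε).2
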